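/- Let $N\ge 2$ and $d\ge N$ be integers, and let $\mathbb R^N$ carry its Euclidean structure. For every $s\in\mathbb N$ let $\mathbb H^{(s)}=\{\ell^{(s)}_1,\dots,\ell^{(s)}_d\}$ be a family of $d$ distinct hyperplanes $\ell^{(s)}_i=\{x\in\mathbb R^N:\langle \mathbf n^{(s)}_i,x\rangle=c^{(s)}_i\}$, $\|\mathbf n^{(s)}_i\|=1$, in general position: any $N$ of them, forming a subfamily $H$, meet in exactly one point $\vartheta_H$, and $\vartheta_H\neq\vartheta_{H'}$ for $H\ne H'$. Let $\Theta^{(s)}=\{\vartheta_H : H\subset\mathbb H^{(s)},\ |H|=N\}$ be the corresponding Chung–Yao lattice, and put $\|\Theta^{(s)}\|=\max\{\|\vartheta\|:\vartheta\in\Theta^{(s)}\}$. Assume (C1) $\|\Theta^{(s)}\|\to 0$ as $s\to\infty$; (C2) there is $\delta>0$ such that for all $s$ and all $1\le i_1<\dots<i_N\le d$ the volume of the parallelotope spanned by $\mathbf n^{(s)}_{i_1},\dots,\mathbf n^{(s)}_{i_N}$ is at least $\delta$. Then every $\Theta^{(s)}$ is an interpolation lattice of degree $d-N$, that is, for every function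 $f$ there is exactly one real polynomial $\mathbf L[\Theta^{(s)};f]$ in $N$ variables of total degree at most $d-N$ which coincides with $f$ on $\Theta^{(s)}$. Moreover, let $R>0$, let $B(0,R)$ be the closed Euclidean ball of centre $0$ and radius $R$, and let $\mathbf T_0^{d-N}(f)$ denote the Taylor polynomial of $f$ at $0$ to the order $d-N$. There is a constant $C$ such that for every $s$ with $\Theta^{(s)}\subset B(0,R)$ (which by (C1) holds for all large $s$), every open set $\Omega\supset B(0,R)$ and every real function $f\in C^{d-N+2}(\Omega)$, $$\max_{x\in B(0,R)}\bigl|\mathbf L[\Theta^{(s)};f](x)-\mathbf T^{d-N}_0(f)(x)\bigr|\le C\,\|\Theta^{(s)}\|\Bigl(\max_{a\in B(0,R)}\|f^{(d-N+1)}(a)\|+\max_{a\in B(0,R)}\|f^{(d-N+2)}(a)\|\Bigr),$$ where $f^{(k)}(a)$ is the $k$-th total derivative and $\|\cdot\|$ the usual norm of a multilinear form. In particular, $C$ depends neither on $f$ nor on $s$. -/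

import Mathlib

open MeasureTheory

namespace ChungYao

noncomputable section

/-- `ℝ^N` with its canonical Euclidean structure. -/
abbrev Space (N : ℕ) : Type := EuclideanSpace ℝ (Fin N)

/-- The hyperplane `{x : ⟨n, x⟩ = c}`. -/
def hyperplane {N : ℕ} (n : Space N) (c : ℝ) : Set (Space N) :=
  {x | inner ℝ n x = c}

/-- The intersection of the hyperplanes `⟨n i, ·⟩ = c i` whose index lies in `H`. -/
def flat {N d : ℕ} (n : Fin d → Space N) (c : Fin d → ℝ) (H : Finset (Fin d)) : Set (Space N) :=
  ⋂ i ∈ H, hyperplane (n i) (c i)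

/-- The `d` hyperplanes `⟨n i, ·⟩ = c i` of `ℝ^N` are distinct and in general position: any `N`
of them meet in exactly one point, and different choices of `N` of them give different points. -/
structure InGeneralPosition {N d : ℕ} (n : Fin d → Space N) (c : Fin d → ℝ) : Prop where
  distinct : Function.Injective fun i => hyperplane (n i) (c i)
  meet_in_point : ∀ H : Finset (Fin d), H.card = N → ∃ ϑ : Space N, flat n c H = {ϑ}
  points_distinct : Set.InjOn (flat n c) {H : Finset (Fin d) | H.card = N}

/-- The Chung-Yao lattice: the points at which `N` of the hyperplanes meet. -/
def lattice {N d : ℕ} (n : Fin d → Space N) (c : Fin d → ℝ) : Set (Space N) :=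
  {x | ∃ H : Finset (Fin d), H.card = N ∧ x ∈ flat n c H}

/-- The supremum of `g` on `B` (a maximum when `B` is nonempty and finite, or nonempty and compact
with `g` continuous on it). -/
def maxOn {α : Type*} (B : Set α) (g : α → ℝ) : ℝ := sSup (g '' B)

/-- The maximum of the Euclidean norms of the points of a (finite) lattice. -/
def latticeNorm {N : ℕ} (A : Set (Space N)) : ℝ := maxOn A fun ϑ => ‖ϑ‖

/-- The `N`-dimensional volume of the parallelotope spanned by `N` vectors of `ℝ^N`. -/
def vol {N : ℕ} (v : Fin N → Space N) : ℝ := (volume (parallelepiped v)).toReal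

/-- The value at `x` of a polynomial in `N` variables. -/
def evalAt {N : ℕ} (p : MvPolynomial (Fin N) ℝ) (x : Space N) : ℝ :=
  MvPolynomial.eval (fun i => x i) p

/-- `p` is a polynomial of degree at most `k` which coincides with `f` on `A`. -/
def Interpolates {N : ℕ} (k : ℕ) (A : Set (Space N)) (f : Space N → ℝ)
    (p : MvPolynomial (Fin N) ℝ) : Prop :=
  p ∈ MvPolynomial.restrictTotalDegree (Fin N) ℝ k ∧ ∀ a ∈ A, evalAt p a = f a

/-- `A` is an interpolation lattice of degree `k`. -/
def IsInterpolationLattice {N : ℕ} (k : ℕ) (A : Set (Space N)) : Prop :=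
  ∀ f : Space N → ℝ, ∃! p : MvPolynomial (Fin N) ℝ, Interpolates k A f p

open Classical in
/-- The Lagrange interpolation polynomial `L[A; f]` of degree at most `k`; it is the unique
polynomial that interpolates `f` when `A` is an interpolation lattice of degree `k`. -/
def lagrange {N : ℕ} (k : ℕ) (A : Set (Space N)) (f : Space N → ℝ) : MvPolynomial (Fin N) ℝ :=
  if h : ∃ p : MvPolynomial (Fin N) ℝ, Interpolates k A f p then h.choose else 0

/-- The Taylor polynomial of `f` at the origin to the order `k`, as a function. -/
def taylorAtZero {N : ℕ} (k : ℕ) (f : Space N → ℝ) (x : Space N) : ℝ :=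
  ∑ j ∈ Finset.range (k + 1), ((j.factorial : ℝ))⁻¹ * iteratedFDeriv ℝ j f 0 (fun _ => x)

end

end ChungYao

/-!
Write `k = d - N`. Interpolation at `Θ` reproduces the Taylor polynomial `T` of `f` at `0`, so
`L[Θ; f] - T` interpolates the remainder `g = f - T`. On the ball of radius `r = ‖Θ‖`, which
contains `Θ`, the `j`-th derivative of `g` is at most `r ^ (k + 1 - j)` times the maximum of
`‖f^(k + 1)‖`, by the mean value inequality started at `0`; for `j ≤ k` this supplies the factor
`r`.

It remains to bound the interpolation polynomial of `g` by the derivatives of `g` up to order `k`.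
Add the hyperplanes one at a time. A new hyperplane contributes one vertex on each line in which
`N - 1` of the old ones meet, and the polynomials which vanish on the other old hyperplanes give the
correction in Newton form. Each coefficient is a univariate interpolation error along such a line,
hence a derivative of `g` times a ratio of distances along the line to distances from
hyperplanes. The direction of the line is the cross product of the `N - 1` normals, so (C2) keeps
that ratio at most `1 / δ`.
-/

namespace ChungYao

section OneVariable

theorem exists_iteratedDeriv_eq_zero {s : Set ℝ} (hs : s.OrdConnected) {m : ℕ} {h : ℝ → ℝ}
    (hh : ∀ y ∈ s, ContDiffAt ℝ m h y) {x : Fin (m + 1) → ℝ} (hx : StrictMono x)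
    (hmem : ∀ i, x i ∈ s) (hzero : ∀ i, h (x i) = 0) : ∃ ξ ∈ s, iteratedDeriv m h ξ = 0 := by
  induction m generalizing h with
  | zero => exact ⟨x 0, hmem 0, by simpa using hzero 0⟩
  | succ m ih =>
    have hsub (i : Fin (m + 1)) : Set.Icc (x i.castSucc) (x i.succ) ⊆ s := hs.out (hmem _) (hmem _)
    have rolle (i : Fin (m + 1)) : ∃ y ∈ Set.Ioo (x i.castSucc) (x i.succ), deriv h y = 0 :=
      exists_deriv_eq_zero (hx i.castSucc_lt_succ)
        (fun z hz => (hh z (hsub i hz)).continuousAt.continuousWithinAt)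
        ((hzero _).trans (hzero _).symm)
    choose y hy hy0 using rolle
    have hymono : StrictMono y := Fin.strictMono_iff_lt_succ.2 fun i =>
      (hy i.castSucc).2.trans (Fin.succ_castSucc i ▸ (hy i.succ).1)
    have hderiv : ∀ z ∈ s, ContDiffAt ℝ m (deriv h) z := fun z hz =>
      ((hh z hz).fderiv_right (by norm_cast)).clm_apply contDiffAt_const
    obtain ⟨ξ, hξ, hξ0⟩ := ih hderiv hymono
      (fun i => hsub i (Set.Ioo_subset_Icc_self (hy i))) hy0
    exact ⟨ξ, hξ, by rw [iteratedDeriv_succ', hξ0]⟩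

open Polynomial

theorem iteratedDeriv_eval (P : ℝ[X]) (m : ℕ) :
    iteratedDeriv m (fun t => P.eval t) = fun t => (derivative^[m] P).eval t := by
  induction m with
  | zero => simp
  | succ m ih =>
    rw [iteratedDeriv_succ, ih, Function.iterate_succ_apply']
    exact funext fun t => Polynomial.deriv _

theorem iteratedDeriv_eval_add_C_mul_nodal {κ : Type*} (I : Finset κ) (t : κ → ℝ) {q : ℝ[X]}
    (hq : q.degree < I.card) (a ξ : ℝ) :
    iteratedDeriv I.card (fun z => (q + C a * Lagrange.nodal I t).eval z) ξ
      = (I.card.factorial : ℝ) * a := by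
  have hnodal : derivative^[I.card] (Lagrange.nodal I t) = C (I.card.factorial : ℝ) := by
    have hdeg : (derivative^[I.card] (Lagrange.nodal I t)).natDegree ≤ 0 :=
      (natDegree_iterate_derivative _ _).trans (by simp [Lagrange.natDegree_nodal])
    have hlead : (Lagrange.nodal I t).coeff I.card = 1 := by
      simpa [Lagrange.natDegree_nodal] using
        (Lagrange.nodal_monic (s := I) (v := t)).coeff_natDegree
    rw [eq_C_of_natDegree_le_zero hdeg, coeff_iterate_derivative]
    simp [hlead, Nat.descFactorial_self]
  rw [iteratedDeriv_eval]
  simp [iterate_derivative_C_mul, iterate_derivative_eq_zero_of_degree_lt hq, hnodal,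
    mul_comm a]

theorem exists_sub_eval_eq_iteratedDeriv_mul_prod {κ : Type*} {s : Set ℝ} (hs : s.OrdConnected)
    {I : Finset κ} {t : κ → ℝ} (ht : Set.InjOn t I) (hts : ∀ i ∈ I, t i ∈ s) {g : ℝ → ℝ}
    (hg : ∀ y ∈ s, ContDiffAt ℝ I.card g y) {q : ℝ[X]} (hq : q.degree < I.card)
    (hqt : ∀ i ∈ I, q.eval (t i) = g (t i)) {τ : ℝ} (hτ : τ ∈ s) (hτt : ∀ i ∈ I, t i ≠ τ) :
    ∃ ξ ∈ s, g τ - q.eval τ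
      = iteratedDeriv I.card g ξ / (I.card.factorial : ℝ) * ∏ i ∈ I, (τ - t i) := by
  classical
  have hw : (Lagrange.nodal I t).eval τ ≠ 0 :=
    Lagrange.eval_nodal_not_at_node fun i hi => (hτt i hi).symm
  -- `P` interpolates `g` at `τ` as well.
  set a : ℝ := (g τ - q.eval τ) / (Lagrange.nodal I t).eval τ with ha
  set P : ℝ[X] := q + C a * Lagrange.nodal I t with hP
  have hPsmooth (y : ℝ) : ContDiffAt ℝ I.card (fun z => P.eval z) y := by
    simpa using (contDiff_aeval (𝕜 := ℝ) P I.card).contDiffAt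
  have hnodes : ∀ z ∈ insert τ (I.image t), z ∈ s ∧ g z - P.eval z = 0 := by
    simp only [Finset.forall_mem_insert, Finset.forall_mem_image]
    refine ⟨⟨hτ, ?_⟩, fun i hi => ⟨hts i hi, ?_⟩⟩
    · simp [hP, ha, div_mul_cancel₀ _ hw]
    · simp [hP, hqt i hi, Lagrange.eval_nodal_at_node hi]
  have hcard : (insert τ (I.image t)).card = I.card + 1 := by
    rw [Finset.card_insert_of_notMem (by simpa using hτt), Finset.card_image_of_injOn ht]
  obtain ⟨ξ, hξ, hξ0⟩ := exists_iteratedDeriv_eq_zero hs (fun y hy => (hg y hy).sub (hPsmooth y))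
    (OrderEmbedding.strictMono (Finset.orderEmbOfFin _ hcard))
    (fun i => (hnodes _ (Finset.orderEmbOfFin_mem _ _ i)).1)
    (fun i => (hnodes _ (Finset.orderEmbOfFin_mem _ _ i)).2)
  have hder : iteratedDeriv I.card g ξ = (I.card.factorial : ℝ) * a := by
    rw [← iteratedDeriv_eval_add_C_mul_nodal I t hq a ξ, ← sub_eq_zero]
    exact (iteratedDeriv_sub (hg ξ hξ) (hPsmooth ξ)).symm.trans hξ0
  refine ⟨ξ, hξ, ?_⟩
  rw [hder, mul_div_cancel_left₀ _ (by positivity), ← Lagrange.eval_nodal, div_mul_cancel₀ _ hw]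

end OneVariable

section Taylor

universe u

variable {E F : Type u} [NormedAddCommGroup E] [NormedSpace ℝ E]
  [NormedAddCommGroup F] [NormedSpace ℝ F]

theorem iteratedFDeriv_fderiv_fderiv_flip {j : ℕ} {f : E → F} {a : E}
    (hf : ContDiffAt ℝ (j + 2 : ℕ) f a) (w : Fin j → E) (u v : E) :
    iteratedFDeriv ℝ j (fderiv ℝ (fderiv ℝ f)) a w u v
      = iteratedFDeriv ℝ j (fderiv ℝ (fderiv ℝ f)) a w v u := by
  let flip : (E →L[ℝ] E →L[ℝ] F) →L[ℝ] (E →L[ℝ] E →L[ℝ] F) :=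
    (ContinuousLinearMap.flipₗᵢ ℝ E E F).toContinuousLinearEquiv.toContinuousLinearMap
  have hflip : flip ∘ fderiv ℝ (fderiv ℝ f) =ᶠ[nhds a] fderiv ℝ (fderiv ℝ f) := by
    filter_upwards [hf.eventually (ENat.natCast_ne_coe_top _)] with y hy
    have hsymm : IsSymmSndFDerivAt ℝ f y := hy.isSymmSndFDerivAt (by
      rw [minSmoothness_of_isRCLikeNormedField]
      exact_mod_cast Nat.le_add_left 2 j)
    ext p q
    exact hsymm.eq q p
  have hD : ContDiffAt ℝ j (fderiv ℝ (fderiv ℝ f)) a :=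
    (hf.fderiv_right (m := (j + 1 : ℕ)) (by norm_cast)).fderiv_right (by norm_cast)
  have h := flip.iteratedFDeriv_comp_left (G := E →L[ℝ] E →L[ℝ] F) hD (i := j) le_rfl
  rw [(hflip.iteratedFDeriv ℝ j).eq_of_nhds] at h
  exact DFunLike.congr_fun (DFunLike.congr_fun (DFunLike.congr_fun h w) u) v

theorem hasFDerivAt_iteratedFDeriv_diag {j : ℕ} {f : E → F} {a : E}
    (hf : ContDiffAt ℝ (j + 1 : ℕ) f a) (x : E) :
    HasFDerivAt (fun y => iteratedFDeriv ℝ (j + 1) f a (fun _ => y))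
      ((j + 1 : ℝ) • iteratedFDeriv ℝ j (fderiv ℝ f) a (fun _ => x)) x := by
  have diag_succ (i : ℕ) {G : Type u} [NormedAddCommGroup G] [NormedSpace ℝ G] (h : E → G)
      (y : E) : iteratedFDeriv ℝ (i + 1) h a (fun _ => y)
        = iteratedFDeriv ℝ i (fderiv ℝ h) a (fun _ => y) y := iteratedFDeriv_succ_apply_right _
  induction j generalizing F with
  | zero =>
    simp only [diag_succ, iteratedFDeriv_zero_apply]
    simpa using (fderiv ℝ f a).hasFDerivAt
  | succ j ih =>
    have h := (ih (hf.fderiv_right (by norm_cast))).clm_apply (hasFDerivAt_id x)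
    simp only [diag_succ (j + 1) f]
    refine h.congr_fderiv ?_
    ext v
    simp only [add_apply, ContinuousLinearMap.comp_apply, ContinuousLinearMap.flip_apply,
      smul_apply, id, ContinuousLinearMap.id_apply]
    rw [iteratedFDeriv_fderiv_fderiv_flip hf, ← diag_succ j (fderiv ℝ f)]
    push_cast
    module

/-- The Taylor polynomial of order `k` at `x₀` of a function between normed spaces. -/
noncomputable def taylorSum (k : ℕ) (f : E → F) (x₀ x : E) : F :=
  ∑ j ∈ Finset.range (k + 1),
    ((j.factorial : ℝ))⁻¹ • iteratedFDeriv ℝ j f x₀ (fun _ => x - x₀)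

theorem contDiff_taylorSum (k : ℕ) (f : E → F) (x₀ : E) {m : WithTop ℕ∞} :
    ContDiff ℝ m (taylorSum k f x₀) :=
  ContDiff.sum fun j _ => contDiff_const.smul <|
    (iteratedFDeriv ℝ j f x₀).contDiff.comp (contDiff_pi.2 fun _ => contDiff_id.sub contDiff_const)

theorem taylorSum_succ' (k : ℕ) (f : E → F) (x₀ : E) :
    taylorSum (k + 1) f x₀ = fun x => (∑ j ∈ Finset.range (k + 1),
      (((j + 1).factorial : ℝ))⁻¹ • iteratedFDeriv ℝ (j + 1) f x₀ (fun _ => x - x₀)) + f x₀ := by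
  ext x
  rw [taylorSum, Finset.sum_range_succ']
  simp

theorem taylorSum_zero (f : E → F) (x₀ : E) : taylorSum 0 f x₀ = fun _ => f x₀ := by
  ext x
  simp [taylorSum]

theorem taylorSum_self (k : ℕ) (f : E → F) (x₀ : E) : taylorSum k f x₀ x₀ = f x₀ := by
  cases k with
  | zero => rw [taylorSum_zero]
  | succ k =>
    simp only [taylorSum_succ', sub_self]
    rw [Finset.sum_eq_zero fun j _ => ?_, zero_add]
    rw [(iteratedFDeriv ℝ (j + 1) f x₀).map_coord_zero 0 rfl, smul_zero]

theorem fderiv_taylorSum_succ {k : ℕ} {f : E → F} {x₀ : E}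
    (hf : ContDiffAt ℝ (k + 1 : ℕ) f x₀) :
    fderiv ℝ (taylorSum (k + 1) f x₀) = taylorSum k (fderiv ℝ f) x₀ := by
  ext1 x
  refine HasFDerivAt.fderiv ?_
  rw [taylorSum_succ']
  refine (HasFDerivAt.fun_sum fun j hj => ?_).add_const _
  have hf' : ContDiffAt ℝ (j + 1 : ℕ) f x₀ :=
    hf.of_le (by exact_mod_cast Finset.mem_range.1 hj)
  have h := ((hasFDerivAt_iteratedFDeriv_diag hf' (x - x₀)).comp x
    ((hasFDerivAt_id x).sub_const x₀)).const_smul (((j + 1).factorial : ℝ))⁻¹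
  refine h.congr_fderiv ?_
  rw [ContinuousLinearMap.comp_id, smul_smul, Nat.factorial_succ]
  congr 1
  push_cast
  field_simp

theorem iteratedFDeriv_taylorSum_self {k j : ℕ} (hj : j ≤ k) {f : E → F} {x₀ : E}
    (hf : ContDiffAt ℝ k f x₀) :
    iteratedFDeriv ℝ j (taylorSum k f x₀) x₀ = iteratedFDeriv ℝ j f x₀ := by
  induction j generalizing k F with
  | zero =>
    ext
    simp [taylorSum_self]
  | succ j ih =>
    obtain ⟨k, rfl⟩ := Nat.exists_eq_add_of_le' (Nat.le_of_add_left_le hj)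
    rw [iteratedFDeriv_succ_eq_comp_right, iteratedFDeriv_succ_eq_comp_right, Function.comp_apply,
      Function.comp_apply, fderiv_taylorSum_succ hf,
      ih (Nat.le_of_succ_le_succ hj) (hf.fderiv_right (by norm_cast))]

theorem iteratedFDeriv_succ_taylorSum {k : ℕ} {f : E → F} {x₀ : E}
    (hf : ContDiffAt ℝ k f x₀) (x : E) :
    iteratedFDeriv ℝ (k + 1) (taylorSum k f x₀) x = 0 := by
  induction k generalizing F with
  | zero => simp [taylorSum_zero, iteratedFDeriv_const_of_ne]
  | succ k ih =>
    rw [iteratedFDeriv_succ_eq_comp_right, Function.comp_apply, fderiv_taylorSum_succ hf,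
      ih (hf.fderiv_right (by norm_cast)), LinearIsometryEquiv.map_zero]

theorem norm_iteratedFDeriv_le_of_iteratedFDeriv_eq_zero {m : ℕ} {g : E → F} {x₀ : E} {r M : ℝ}
    (hr : 0 ≤ r) (hg : ∀ a ∈ Metric.closedBall x₀ r, ContDiffAt ℝ m g a)
    (h0 : ∀ j < m, iteratedFDeriv ℝ j g x₀ = 0)
    (hM : ∀ a ∈ Metric.closedBall x₀ r, ‖iteratedFDeriv ℝ m g a‖ ≤ M) {j : ℕ} (hj : j ≤ m) :
    ∀ a ∈ Metric.closedBall x₀ r, ‖iteratedFDeriv ℝ j g a‖ ≤ M * r ^ (m - j) := by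
  induction hj using Nat.decreasingInduction with
  | self => simpa using hM
  | of_succ j hj ih =>
    intro a ha
    have hx₀ : x₀ ∈ Metric.closedBall x₀ r := Metric.mem_closedBall_self hr
    have hbound := (convex_closedBall x₀ r).norm_image_sub_le_of_norm_fderiv_le (𝕜 := ℝ)
      (fun b hb => (hg b hb).differentiableAt_iteratedFDeriv (by exact_mod_cast hj))
      (fun b hb => norm_fderiv_iteratedFDeriv.trans_le (ih b hb)) hx₀ ha
    rw [h0 j hj, sub_zero] at hbound
    have hnonneg : 0 ≤ M * r ^ (m - (j + 1)) := (norm_nonneg _).trans (ih x₀ hx₀)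
    calc ‖iteratedFDeriv ℝ j g a‖ ≤ M * r ^ (m - (j + 1)) * ‖a - x₀‖ := hbound
      _ ≤ M * r ^ (m - (j + 1)) * r :=
        mul_le_mul_of_nonneg_left (mem_closedBall_iff_norm.1 ha) hnonneg
      _ = M * r ^ (m - j) := by
        rw [mul_assoc, ← pow_succ, ← Nat.sub_add_comm hj, Nat.add_sub_add_right]

theorem norm_iteratedFDeriv_sub_taylorSum_le {k : ℕ} {f : E → F} {x₀ : E} {r M : ℝ} (hr : 0 ≤ r)
    (hf : ∀ a ∈ Metric.closedBall x₀ r, ContDiffAt ℝ (k + 1 : ℕ) f a)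
    (hM : ∀ a ∈ Metric.closedBall x₀ r, ‖iteratedFDeriv ℝ (k + 1) f a‖ ≤ M) {j : ℕ}
    (hj : j ≤ k + 1) :
    ∀ a ∈ Metric.closedBall x₀ r,
      ‖iteratedFDeriv ℝ j (f - taylorSum k f x₀) a‖ ≤ M * r ^ (k + 1 - j) := by
  have hk : ((k : ℕ) : WithTop ℕ∞) ≤ (k + 1 : ℕ) := by exact_mod_cast k.le_succ
  have hT (a : E) : ContDiffAt ℝ (k + 1 : ℕ) (taylorSum k f x₀) a :=
    (contDiff_taylorSum k f x₀).contDiffAt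
  have hx₀ : ContDiffAt ℝ (k + 1 : ℕ) f x₀ := hf x₀ (Metric.mem_closedBall_self hr)
  refine norm_iteratedFDeriv_le_of_iteratedFDeriv_eq_zero (g := f - taylorSum k f x₀) hr
    (fun a ha => (hf a ha).sub (hT a)) (fun i hi => ?_) (fun a ha => ?_) hj
  · have hi' : (i : WithTop ℕ∞) ≤ (k + 1 : ℕ) := by exact_mod_cast hi.le
    rw [iteratedFDeriv_sub_apply (hx₀.of_le hi') ((hT x₀).of_le hi'),
      iteratedFDeriv_taylorSum_self (Nat.lt_succ_iff.1 hi) (hx₀.of_le hk), sub_self]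
  · rw [iteratedFDeriv_sub_apply (hf a ha) (hT a), iteratedFDeriv_succ_taylorSum (hx₀.of_le hk),
      sub_zero]
    exact hM a ha

end Taylor

section Volume

theorem exists_inner_eq_volumeForm_cons {E : Type*} [NormedAddCommGroup E] [InnerProductSpace ℝ E]
    {m : ℕ} [Fact (Module.finrank ℝ E = m + 1)] (o : Orientation ℝ E (Fin (m + 1)))
    (w : Fin m → E) :
    ∃ u : E, ‖u‖ ≤ ∏ j, ‖w j‖ ∧
      ∀ v, inner ℝ v u = o.volumeForm (Fin.cons v w : Fin (m + 1) → E) := by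
  have : FiniteDimensional ℝ E :=
    .of_finrank_pos ((Fact.out : Module.finrank ℝ E = m + 1) ▸ m.succ_pos)
  let φ : E →ₗ[ℝ] ℝ :=
    o.volumeForm.toMultilinearMap.toLinearMap (Fin.cons 0 w : Fin (m + 1) → E) 0
  obtain ⟨u, hu⟩ := (InnerProductSpace.toDual ℝ E).surjective (LinearMap.toContinuousLinearMap φ)
  have hinner (v : E) : inner ℝ v u = o.volumeForm (Fin.cons v w : Fin (m + 1) → E) := by
    rw [real_inner_comm, ← InnerProductSpace.toDual_apply_apply (𝕜 := ℝ), hu]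
    simp [φ, Fin.update_cons_zero]
  refine ⟨u, ?_, hinner⟩
  rcases eq_or_ne u 0 with rfl | hu0
  · simpa using Finset.prod_nonneg fun j _ => norm_nonneg (w j)
  · have hadamard : ‖u‖ * ‖u‖ ≤ ‖u‖ * ∏ j, ‖w j‖ := by
      rw [← real_inner_self_eq_norm_mul_norm, hinner]
      simpa [Fin.prod_univ_succ] using
        (le_abs_self _).trans (o.abs_volumeForm_apply_le (Fin.cons u w : Fin (m + 1) → E))
    exact le_of_mul_le_mul_left hadamard (norm_pos_iff.2 hu0)

variable {N d : ℕ}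

theorem abs_volumeForm_eq_vol [Fact (Module.finrank ℝ (Space N) = N)]
    (o : Orientation ℝ (Space N) (Fin N)) (v : Fin N → Space N) : |o.volumeForm v| = vol v := by
  rw [vol, ← o.measure_eq_volume, AlternatingMap.measure_parallelepiped,
    ENNReal.toReal_ofReal (abs_nonneg _)]

theorem exists_orderEmbedding_vol_eq (n : Fin d → Space N) {e : Fin N → Fin d}
    (he : Function.Injective e) :
    ∃ i : Fin N ↪o Fin d, vol (fun j => n (i j)) = vol (fun j => n (e j)) := by
  have hcard : (Finset.univ.image e).card = N := by
    rw [Finset.card_image_of_injective _ he, Finset.card_univ, Fintype.card_fin]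
  have hrange (j : Fin N) : ∃ l, (Finset.univ.image e).orderEmbOfFin hcard l = e j := by
    rw [← Set.mem_range, Finset.range_orderEmbOfFin]
    simp
  choose σ hσ using hrange
  have hσbij : σ.Bijective :=
    Finite.injective_iff_bijective.1 fun a b hab => he (by rw [← hσ a, ← hσ b, hab])
  refine ⟨(Finset.univ.image e).orderEmbOfFin hcard, ?_⟩
  simp only [vol, ← hσ]
  exact congrArg (fun P => (volume P).toReal) (parallelepiped_comp_equiv
    (fun j => n ((Finset.univ.image e).orderEmbOfFin hcard j)) (.ofBijective σ hσbij)).symm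

theorem exists_inner_eq_zero_forall_le_abs_inner {n : Fin d → Space N}
    (hunit : ∀ i, ‖n i‖ = 1) {δ : ℝ} (hvol : ∀ i : Fin N ↪o Fin d, δ ≤ vol (fun j => n (i j)))
    {K : Finset (Fin d)} (hK : K.card + 1 = N) :
    ∃ u : Space N, ‖u‖ ≤ 1 ∧ (∀ j ∈ K, inner ℝ (n j) u = 0) ∧
      ∀ i ∉ K, δ ≤ |inner ℝ (n i) u| := by
  obtain ⟨m, rfl⟩ : ∃ m, N = m + 1 := ⟨_, hK.symm⟩
  have : Fact (Module.finrank ℝ (Space (m + 1)) = m + 1) := ⟨finrank_euclideanSpace_fin⟩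
  let o : Orientation ℝ (Space (m + 1)) (Fin (m + 1)) :=
    (EuclideanSpace.basisFun (Fin (m + 1)) ℝ).toBasis.orientation
  let κ : Fin m ↪o Fin d := K.orderEmbOfFin (Nat.succ_injective hK)
  have hκ : Set.range κ = K := Finset.range_orderEmbOfFin _ _
  obtain ⟨u, hu, hinner⟩ := exists_inner_eq_volumeForm_cons o fun j => n (κ j)
  refine ⟨u, by simpa [hunit] using hu, fun j hj => ?_, fun i hi => ?_⟩
  · obtain ⟨l, rfl⟩ : j ∈ Set.range κ := hκ ▸ hj
    rw [hinner]
    exact o.volumeForm.map_eq_zero_of_eq _ (i := 0) (j := l.succ) (by simp)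
      (Fin.succ_ne_zero l).symm
  · have hinj : Function.Injective (Fin.cons i κ : Fin (m + 1) → Fin d) :=
      Fin.cons_injective_iff.2 ⟨by rwa [hκ], κ.injective⟩
    have hcons : (Fin.cons (n i) fun j => n (κ j) : Fin (m + 1) → Space (m + 1))
        = fun j => n ((Fin.cons i κ : Fin (m + 1) → Fin d) j) :=
      funext (Fin.cases rfl fun _ => rfl)
    obtain ⟨e, he⟩ := exists_orderEmbedding_vol_eq n hinj
    rw [hinner, abs_volumeForm_eq_vol, hcons, ← he]
    exact hvol e

end Volume

section Polynomials

open MvPolynomial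

variable {N : ℕ}

theorem card_finsupp_degree_le (N k : ℕ) :
    Nat.card {m : Fin N →₀ ℕ // (m.sum fun _ e => e) ≤ k} = (N + k).choose k := by
  have hmem (v : Fin (N + 1) →₀ ℕ) :
      v ∈ Finset.finsuppAntidiag Finset.univ k ↔ v 0 + v.tail.sum (fun _ e => e) = k := by
    simp [Finset.mem_finsuppAntidiag, Fin.sum_univ_succ, Finsupp.sum_fintype, Finsupp.tail_apply]
  let homogenize : {m : Fin N →₀ ℕ // (m.sum fun _ e => e) ≤ k} ≃
      Finset.finsuppAntidiag (Finset.univ : Finset (Fin (N + 1))) k :=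
    { toFun m := ⟨Finsupp.cons (k - m.1.sum fun _ e => e) m.1, (hmem _).2 <| by
        rw [Finsupp.cons_zero, Finsupp.tail_cons, Nat.sub_add_cancel m.2]⟩
      invFun v := ⟨v.1.tail, by have := (hmem v.1).1 v.2; omega⟩
      left_inv m := by simp
      right_inv v := Subtype.ext <| by
        change Finsupp.cons (k - v.1.tail.sum fun _ e => e) v.1.tail = v.1
        rw [Nat.sub_eq_of_eq_add ((hmem v.1).1 v.2).symm, Finsupp.cons_tail] }
  rw [Nat.card_congr homogenize, Nat.card_eq_fintype_card, Fintype.card_coe,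
    Finset.card_finsuppAntidiag_nat_eq_choose, Finset.card_univ, Fintype.card_fin]
  congr 1
  omega

theorem finrank_restrictTotalDegree (R : Type*) [CommRing R] [Nontrivial R] (N k : ℕ) :
    Module.finrank R (restrictTotalDegree (Fin N) R k) = (N + k).choose k :=
  (Module.finrank_eq_nat_card_basis (basisRestrictSupport R _)).trans (card_finsupp_degree_le N k)

theorem C_mul_mem_restrictTotalDegree {σ R : Type*} [CommSemiring R] {k : ℕ} (a : R)
    {p : MvPolynomial σ R} (hp : p ∈ restrictTotalDegree σ R k) :
    C a * p ∈ restrictTotalDegree σ R k := by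
  rw [C_mul']
  exact Submodule.smul_mem _ _ hp

theorem restrictTotalDegree_mono {σ R : Type*} [CommSemiring R] {k l : ℕ} (hkl : k ≤ l) :
    restrictTotalDegree σ R k ≤ restrictTotalDegree σ R l :=
  fun p hp => by rw [mem_restrictTotalDegree] at hp ⊢; exact hp.trans hkl

theorem evalAt_add (p q : MvPolynomial (Fin N) ℝ) (x : Space N) :
    evalAt (p + q) x = evalAt p x + evalAt q x := by simp [evalAt]

theorem evalAt_sub (p q : MvPolynomial (Fin N) ℝ) (x : Space N) :
    evalAt (p - q) x = evalAt p x - evalAt q x := by simp [evalAt]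

theorem evalAt_sum {κ : Type*} (s : Finset κ) (p : κ → MvPolynomial (Fin N) ℝ) (x : Space N) :
    evalAt (∑ i ∈ s, p i) x = ∑ i ∈ s, evalAt (p i) x := by simp [evalAt]

theorem evalAt_C_mul (a : ℝ) (p : MvPolynomial (Fin N) ℝ) (x : Space N) :
    evalAt (C a * p) x = a * evalAt p x := by simp [evalAt]

theorem isInterpolationLattice_range {κ : Type*} [Fintype κ] {k : ℕ} {a : κ → Space N}
    (hcard : Fintype.card κ = (N + k).choose k) {q : κ → MvPolynomial (Fin N) ℝ}
    (hq : ∀ i, q i ∈ restrictTotalDegree (Fin N) ℝ k)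
    (hqa : ∀ i j, evalAt (q i) (a j) = 0 ↔ i ≠ j) :
    IsInterpolationLattice k (Set.range a) := by
  let ev : restrictTotalDegree (Fin N) ℝ k →ₗ[ℝ] (κ → ℝ) :=
    { toFun p i := evalAt p.1 (a i)
      map_add' p q := funext fun i => evalAt_add _ _ _
      map_smul' b p := funext fun i => by simp [evalAt, smul_eval] }
  have hsurj : Function.Surjective ev := fun y => by
    refine ⟨⟨∑ i, C (y i / evalAt (q i) (a i)) * q i,
      Submodule.sum_mem _ fun i _ => C_mul_mem_restrictTotalDegree _ (hq i)⟩, funext fun j => ?_⟩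
    have hqj : evalAt (q j) (a j) ≠ 0 := fun h => (hqa j j).1 h rfl
    change evalAt _ _ = _
    rw [evalAt_sum, Finset.sum_eq_single j, evalAt_C_mul, div_mul_cancel₀ _ hqj]
    · intro i _ hij
      rw [evalAt_C_mul, (hqa i j).2 hij, mul_zero]
    · simp
  have hbij : Function.Bijective ev := by
    refine ⟨(LinearMap.injective_iff_surjective_of_finrank_eq_finrank ?_).2 hsurj, hsurj⟩
    rw [finrank_restrictTotalDegree, Module.finrank_fintype_fun_eq_card, hcard]
  intro f
  obtain ⟨p, hp, huniq⟩ := hbij.existsUnique fun i => f (a i)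
  refine ⟨p.1, ⟨p.2, Set.forall_mem_range.2 (congrFun hp)⟩, fun p' hp' => ?_⟩
  exact congrArg Subtype.val (huniq ⟨p', hp'.1⟩ (funext (Set.forall_mem_range.1 hp'.2)))

theorem interpolates_lagrange {k : ℕ} {A : Set (Space N)} (hA : IsInterpolationLattice k A)
    (f : Space N → ℝ) : Interpolates k A f (lagrange k A f) := by
  have h := (hA f).exists
  rw [lagrange, dif_pos h]
  exact h.choose_spec

theorem exists_evalAt_eq_diag {j : ℕ} (T : MultilinearMap ℝ (fun _ : Fin j => Space N) ℝ) :
    ∃ q ∈ restrictTotalDegree (Fin N) ℝ j, ∀ x, evalAt q x = T fun _ => x := by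
  let e : Fin N → Space N := fun i => EuclideanSpace.single i 1
  refine ⟨∑ σ : Fin j → Fin N, C (T fun l => e (σ l)) * ∏ l, X (σ l), ?_, fun x => ?_⟩
  · refine Submodule.sum_mem _ fun σ _ => C_mul_mem_restrictTotalDegree _ ?_
    rw [mem_restrictTotalDegree]
    exact (totalDegree_finsetProd _ _).trans (by simp)
  · have hx : x = ∑ i, x i • e i := by
      ext i
      simp [e, Finset.sum_apply, Pi.single_apply]
    conv_rhs => rw [hx, MultilinearMap.map_sum]
    rw [evalAt_sum]
    refine Finset.sum_congr rfl fun σ _ => ?_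
    rw [MultilinearMap.map_smul_univ, evalAt_C_mul, smul_eq_mul, mul_comm]
    simp [evalAt, map_prod]

theorem exists_evalAt_eq_taylorAtZero (k : ℕ) (f : Space N → ℝ) :
    ∃ q ∈ restrictTotalDegree (Fin N) ℝ k, ∀ x, evalAt q x = taylorAtZero k f x := by
  choose q hq hqx using fun j =>
    exists_evalAt_eq_diag (iteratedFDeriv ℝ j f 0).toMultilinearMap
  refine ⟨∑ j ∈ Finset.range (k + 1), C ((j.factorial : ℝ))⁻¹ * q j,
    Submodule.sum_mem _ fun j hj => C_mul_mem_restrictTotalDegree _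
      (restrictTotalDegree_mono (Nat.lt_succ_iff.1 (Finset.mem_range.1 hj)) (hq j)), fun x => ?_⟩
  simp only [evalAt_sum, evalAt_C_mul, hqx, taylorAtZero, ContinuousMultilinearMap.coe_coe]

theorem exists_polynomial_eval_eq_evalAt_add_smul {k : ℕ} {p : MvPolynomial (Fin N) ℝ}
    (hp : p ∈ restrictTotalDegree (Fin N) ℝ k) (a u : Space N) :
    ∃ q : Polynomial ℝ, q.natDegree ≤ k ∧ ∀ t : ℝ, q.eval t = evalAt p (a + t • u) := by
  rw [mem_restrictTotalDegree] at hp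
  refine ⟨aeval (fun i => Polynomial.C (a i) + Polynomial.X * Polynomial.C (u i)) p, ?_,
    fun t => ?_⟩
  · refine (aeval_natDegree_le p hp _ (n := 1) fun i => ?_).trans (mul_one k).le
    compute_degree
  · have hC : (Polynomial.evalRingHom t).comp (algebraMap ℝ (Polynomial ℝ)) = RingHom.id ℝ :=
      RingHom.ext fun b => by simp
    rw [aeval_def, polynomial_eval_eval₂, hC, evalAt, eval₂_id]
    simp [mul_comm t]

end Polynomials

section Faces

open MvPolynomial

variable {N d : ℕ} {n : Fin d → Space N} {c : Fin d → ℝ}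

theorem mem_flat {H : Finset (Fin d)} {x : Space N} :
    x ∈ flat n c H ↔ ∀ i ∈ H, inner ℝ (n i) x = c i := by
  simp [flat, hyperplane]

/-- The point `ϑ_H` at which the hyperplanes with index in `H` meet; an arbitrary point when `H` has
no common point, and an arbitrary common point when there are several. -/
noncomputable def vertex (n : Fin d → Space N) (c : Fin d → ℝ) (H : Finset (Fin d)) : Space N :=
  Classical.epsilon (· ∈ flat n c H)

/-- The Chung–Yao lattice of the subfamily of hyperplanes with index in `S`. -/
noncomputable def latticeOn (n : Fin d → Space N) (c : Fin d → ℝ) (S : Finset (Fin d)) :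
    Set (Space N) :=
  vertex n c '' (S.powersetCard N)

theorem vertex_mem_latticeOn {S H : Finset (Fin d)} (hHS : H ⊆ S) (hH : H.card = N) :
    vertex n c H ∈ latticeOn n c S :=
  Set.mem_image_of_mem _ (Finset.mem_powersetCard.2 ⟨hHS, hH⟩)

theorem latticeOn_mono {S T : Finset (Fin d)} (hST : S ⊆ T) : latticeOn n c S ⊆ latticeOn n c T :=
  Set.image_mono (Finset.coe_subset.2 (Finset.powersetCard_mono hST))

theorem forall_mem_latticeOn {S : Finset (Fin d)} {P : Space N → Prop} :
    (∀ x ∈ latticeOn n c S, P x) ↔ ∀ H ⊆ S, H.card = N → P (vertex n c H) :=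
  Set.forall_mem_image.trans <| by simp only [Finset.mem_coe, Finset.mem_powersetCard, and_imp]

namespace InGeneralPosition

theorem flat_eq_singleton (hgen : InGeneralPosition n c) {H : Finset (Fin d)} (hH : H.card = N) :
    flat n c H = {vertex n c H} := by
  obtain ⟨ϑ, hϑ⟩ := hgen.meet_in_point H hH
  have hmem : vertex n c H ∈ flat n c H := Classical.epsilon_spec ⟨ϑ, hϑ ▸ Set.mem_singleton ϑ⟩
  rw [hϑ] at hmem ⊢
  rw [Set.mem_singleton_iff.1 hmem]

theorem mem_flat_iff (hgen : InGeneralPosition n c) {H : Finset (Fin d)} (hH : H.card = N)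
    {x : Space N} : x ∈ flat n c H ↔ x = vertex n c H := by
  rw [hgen.flat_eq_singleton hH, Set.mem_singleton_iff]

theorem inner_vertex (hgen : InGeneralPosition n c) {H : Finset (Fin d)} (hH : H.card = N)
    {i : Fin d} (hi : i ∈ H) : inner ℝ (n i) (vertex n c H) = c i :=
  mem_flat.1 ((hgen.mem_flat_iff hH).2 rfl) i hi

theorem vertex_injOn (hgen : InGeneralPosition n c) :
    Set.InjOn (vertex n c) {H | H.card = N} := fun H hH H' hH' h =>
  hgen.points_distinct hH hH' (by rw [hgen.flat_eq_singleton hH, hgen.flat_eq_singleton hH', h])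

theorem latticeOn_univ (hgen : InGeneralPosition n c) :
    latticeOn n c Finset.univ = lattice n c := by
  ext x
  simp only [latticeOn, lattice, Set.mem_image, Finset.mem_coe, Finset.mem_powersetCard_univ,
    Set.mem_ofPred_eq]
  exact exists_congr fun H => and_congr_right fun hH => by rw [hgen.mem_flat_iff hH, eq_comm]

theorem inner_vertex_eq_iff (hgen : InGeneralPosition n c) (hN : 0 < N) {H : Finset (Fin d)}
    (hH : H.card = N) {i : Fin d} : inner ℝ (n i) (vertex n c H) = c i ↔ i ∈ H := by
  refine ⟨fun hi => ?_, hgen.inner_vertex hH⟩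
  by_contra hiH
  -- Exchanging an element of `H` for `i` would give a second index set for the same vertex.
  obtain ⟨j, hj⟩ : H.Nonempty := Finset.card_pos.1 (hH ▸ hN)
  have hcard : (insert i (H.erase j)).card = N := by
    rw [Finset.card_insert_of_notMem fun h => hiH (Finset.mem_of_mem_erase h),
      Finset.card_erase_add_one hj, hH]
  have hflat : vertex n c H ∈ flat n c (insert i (H.erase j)) := by
    rw [mem_flat, Finset.forall_mem_insert]
    exact ⟨hi, fun l hl => hgen.inner_vertex hH (Finset.mem_of_mem_erase hl)⟩
  have heq : H = insert i (H.erase j) :=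
    hgen.vertex_injOn hH hcard ((hgen.mem_flat_iff hcard).1 hflat)
  exact hiH (heq ▸ Finset.mem_insert_self i _)

end InGeneralPosition

/-- The affine polynomial `⟨v, x⟩ - b`. -/
noncomputable def affinePoly (v : Space N) (b : ℝ) : MvPolynomial (Fin N) ℝ :=
  ∑ i, C (v i) * X i - C b

theorem evalAt_affinePoly (v : Space N) (b : ℝ) (x : Space N) :
    evalAt (affinePoly v b) x = inner ℝ v x - b := by
  simp [evalAt, affinePoly, PiLp.inner_apply, mul_comm]

theorem totalDegree_affinePoly_le (v : Space N) (b : ℝ) : (affinePoly v b).totalDegree ≤ 1 := by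
  refine (totalDegree_sub _ _).trans (max_le ?_ (by simp))
  exact totalDegree_finsetSum_le fun i _ => (totalDegree_mul _ _).trans (by simp)

/-- The product of the affine polynomials which define the hyperplanes with index in `I`. -/
noncomputable def facePoly (n : Fin d → Space N) (c : Fin d → ℝ) (I : Finset (Fin d)) :
    MvPolynomial (Fin N) ℝ :=
  ∏ i ∈ I, affinePoly (n i) (c i)

theorem evalAt_facePoly (n : Fin d → Space N) (c : Fin d → ℝ) (I : Finset (Fin d)) (x : Space N) :
    evalAt (facePoly n c I) x = ∏ i ∈ I, (inner ℝ (n i) x - c i) := by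
  simp only [← evalAt_affinePoly]
  simp [evalAt, facePoly, map_prod]

theorem facePoly_mem_restrictTotalDegree (n : Fin d → Space N) (c : Fin d → ℝ)
    (I : Finset (Fin d)) : facePoly n c I ∈ restrictTotalDegree (Fin N) ℝ I.card := by
  rw [mem_restrictTotalDegree]
  refine (totalDegree_finsetProd _ _).trans ?_
  exact (Finset.sum_le_sum fun i _ => totalDegree_affinePoly_le (n i) (c i)).trans (by simp)

theorem abs_evalAt_facePoly_le {ρ : ℝ} {x : Space N} (hx : ∀ i, |inner ℝ (n i) x - c i| ≤ ρ)
    (I : Finset (Fin d)) : |evalAt (facePoly n c I) x| ≤ ρ ^ I.card := by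
  rw [evalAt_facePoly, Finset.abs_prod, ← Finset.prod_const]
  exact Finset.prod_le_prod (fun _ _ => abs_nonneg _) fun i _ => hx i

theorem evalAt_facePoly_vertex_eq_zero_iff (hN : 0 < N) (hgen : InGeneralPosition n c)
    {H : Finset (Fin d)} (hH : H.card = N) (I : Finset (Fin d)) :
    evalAt (facePoly n c I) (vertex n c H) = 0 ↔ ¬ Disjoint H I := by
  simp only [evalAt_facePoly, Finset.prod_eq_zero_iff, sub_eq_zero,
    hgen.inner_vertex_eq_iff hN hH, Finset.not_disjoint_iff, and_comm]

theorem isInterpolationLattice_lattice (hN : 0 < N) (hd : N ≤ d) (hgen : InGeneralPosition n c) :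
    IsInterpolationLattice (d - N) (lattice n c) := by
  have hlattice : lattice n c =
      Set.range fun H : {H : Finset (Fin d) // H.card = N} => vertex n c H := by
    rw [← hgen.latticeOn_univ, latticeOn, Set.image_eq_range]
    ext x
    simp
  rw [hlattice]
  refine isInterpolationLattice_range (q := fun H => facePoly n c H.1ᶜ) ?_ (fun H => ?_)
    fun H H' => ?_
  · rw [Fintype.card_finset_len, Fintype.card_fin, Nat.add_sub_cancel' hd, Nat.choose_symm hd]
  · simpa [Finset.card_compl, H.2] using facePoly_mem_restrictTotalDegree n c H.1ᶜ
  · rw [evalAt_facePoly_vertex_eq_zero_iff hN hgen H'.2, disjoint_compl_right_iff, not_iff_not,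
      Subtype.ext_iff]
    exact ⟨fun h => (Finset.eq_of_subset_of_card_le h (H.2.trans H'.2.symm).le).symm,
      fun h => h ▸ subset_rfl⟩

end Faces

section Newton

variable {N d : ℕ}

theorem iteratedDeriv_comp_add_smul {E F : Type*} [NormedAddCommGroup E] [NormedSpace ℝ E]
    [NormedAddCommGroup F] [NormedSpace ℝ F] {m : ℕ} {g : E → F} {a u : E} {ξ : ℝ}
    (hg : ContDiffAt ℝ m g (a + ξ • u)) :
    iteratedDeriv m (fun t => g (a + t • u)) ξ = iteratedFDeriv ℝ m g (a + ξ • u) fun _ => u := by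
  induction m generalizing ξ with
  | zero => simp
  | succ m ih =>
    have hline : Continuous fun t : ℝ => a + t • u := by fun_prop
    have hnear : iteratedDeriv m (fun t => g (a + t • u)) =ᶠ[nhds ξ]
        fun t => iteratedFDeriv ℝ m g (a + t • u) fun _ => u := by
      have hsmooth := hline.continuousAt.eventually (hg.eventually (ENat.natCast_ne_coe_top _))
      filter_upwards [hsmooth] with t ht
      exact ih (ht.of_le (by exact_mod_cast m.le_succ))
    rw [iteratedDeriv_succ, hnear.deriv_eq]
    exact hg.deriv_fderiv_add_smul

theorem abs_sub_evalAt_le_prod_norm_smul {κ : Type*} {I : Finset κ} {k : ℕ} (hk : k < I.card)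
    {p : MvPolynomial (Fin N) ℝ} (hp : p ∈ MvPolynomial.restrictTotalDegree (Fin N) ℝ k)
    {s : Set (Space N)} (hs : Convex ℝ s) {g : Space N → ℝ}
    (hg : ∀ y ∈ s, ContDiffAt ℝ I.card g y) {M : ℝ}
    (hM : ∀ y ∈ s, ‖iteratedFDeriv ℝ I.card g y‖ ≤ M) {a u : Space N} (ha : a ∈ s) {t : κ → ℝ}
    (ht : Set.InjOn t I) (ht0 : ∀ i ∈ I, t i ≠ 0) (hts : ∀ i ∈ I, a + t i • u ∈ s)
    (hpt : ∀ i ∈ I, evalAt p (a + t i • u) = g (a + t i • u)) :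
    |g a - evalAt p a| ≤ M / (I.card.factorial : ℝ) * ∏ i ∈ I, ‖t i • u‖ := by
  obtain ⟨q, hq, hqt⟩ := exists_polynomial_eval_eq_evalAt_add_smul hp a u
  have hpre : Convex ℝ ((fun z : ℝ => a + z • u) ⁻¹' s) :=
    (hs.translate_preimage_right a).linear_preimage (LinearMap.toSpanSingleton ℝ (Space N) u)
  have hline (z : ℝ) (hz : a + z • u ∈ s) : ContDiffAt ℝ I.card (fun z : ℝ => g (a + z • u)) z :=
    (hg _ hz).comp z (by fun_prop)
  obtain ⟨ξ, hξ, herr⟩ := exists_sub_eval_eq_iteratedDeriv_mul_prod hpre.ordConnected ht hts hline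
    ((Polynomial.degree_le_of_natDegree_le hq).trans_lt (by exact_mod_cast hk))
    (fun i hi => (hqt _).trans (hpt i hi)) (τ := 0) (by simpa using ha) ht0
  rw [iteratedDeriv_comp_add_smul (hg _ hξ), hqt] at herr
  simp only [zero_smul, add_zero, zero_sub] at herr
  have hder : |iteratedFDeriv ℝ I.card g (a + ξ • u) fun _ => u| ≤ M * ‖u‖ ^ I.card := by
    rw [← Real.norm_eq_abs]
    refine (ContinuousMultilinearMap.le_opNorm _ _).trans ?_
    rw [Finset.prod_const, Finset.card_univ, Fintype.card_fin]
    exact mul_le_mul_of_nonneg_right (hM _ hξ) (by positivity)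
  calc |g a - evalAt p a|
      = |iteratedFDeriv ℝ I.card g (a + ξ • u) fun _ => u| / (I.card.factorial : ℝ)
          * ∏ i ∈ I, |t i| := by
        rw [herr, abs_mul, abs_div, Nat.abs_cast, Finset.abs_prod]
        simp only [abs_neg]
    _ ≤ M * ‖u‖ ^ I.card / (I.card.factorial : ℝ) * ∏ i ∈ I, |t i| := by gcongr
    _ = M / (I.card.factorial : ℝ) * ∏ i ∈ I, ‖t i • u‖ := by
        simp only [norm_smul, Real.norm_eq_abs, Finset.prod_mul_distrib, Finset.prod_const]
        ring

variable {n : Fin d → Space N} {c : Fin d → ℝ} {g : Space N → ℝ}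

theorem exists_vertex_insert_eq_add_smul (hunit : ∀ i, ‖n i‖ = 1) (hgen : InGeneralPosition n c)
    {δ : ℝ} (hδ : 0 < δ) (hvol : ∀ i : Fin N ↪o Fin d, δ ≤ vol (fun j => n (i j)))
    {K : Finset (Fin d)} (hK : K.card + 1 = N) {a : Space N} (ha : a ∈ flat n c K) :
    ∃ (u : Space N) (t : Fin d → ℝ), ∀ i ∉ K, vertex n c (insert i K) = a + t i • u ∧
      ‖t i • u‖ ≤ |inner ℝ (n i) a - c i| / δ := by
  obtain ⟨u, hu, huK, huδ⟩ := exists_inner_eq_zero_forall_le_abs_inner hunit hvol hK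
  refine ⟨u, fun i => (c i - inner ℝ (n i) a) / inner ℝ (n i) u, fun i hi => ⟨?_, ?_⟩⟩
  · have hiu : inner ℝ (n i) u ≠ 0 := abs_pos.1 (hδ.trans_le (huδ i hi))
    have hcard : (insert i K).card = N := (Finset.card_insert_of_notMem hi).trans hK
    refine ((hgen.mem_flat_iff hcard).1 (mem_flat.2 ?_)).symm
    simp only [inner_add_right, real_inner_smul_right, Finset.forall_mem_insert]
    refine ⟨by rw [div_mul_cancel₀ _ hiu, add_sub_cancel], fun j hj => ?_⟩
    rw [huK j hj, mul_zero, add_zero, mem_flat.1 ha j hj]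
  · rw [norm_smul, Real.norm_eq_abs, abs_div, abs_sub_comm]
    refine (mul_le_of_le_one_right (by positivity) hu).trans ?_
    exact div_le_div_of_nonneg_left (abs_nonneg _) hδ (huδ i hi)

theorem abs_sub_evalAt_vertex_le (hunit : ∀ i, ‖n i‖ = 1) (hgen : InGeneralPosition n c) {δ : ℝ}
    (hδ : 0 < δ) (hvol : ∀ i : Fin N ↪o Fin d, δ ≤ vol (fun j => n (i j))) {s : Set (Space N)}
    (hs : Convex ℝ s) {K I : Finset (Fin d)} {e : Fin d} (hK : K.card + 1 = N) (he : e ∉ K)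
    (hI : Disjoint I (insert e K)) (hse : vertex n c (insert e K) ∈ s)
    (hsI : ∀ i ∈ I, vertex n c (insert i K) ∈ s) (hg : ∀ y ∈ s, ContDiffAt ℝ I.card g y) {M : ℝ}
    (hM : ∀ y ∈ s, ‖iteratedFDeriv ℝ I.card g y‖ ≤ M) {k : ℕ} (hk : k < I.card)
    {p : MvPolynomial (Fin N) ℝ} (hp : p ∈ MvPolynomial.restrictTotalDegree (Fin N) ℝ k)
    (hpI : ∀ i ∈ I, evalAt p (vertex n c (insert i K)) = g (vertex n c (insert i K))) :
    |g (vertex n c (insert e K)) - evalAt p (vertex n c (insert e K))|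
      ≤ M / δ ^ I.card * |evalAt (facePoly n c I) (vertex n c (insert e K))| := by
  have hcard {i : Fin d} (hi : i ∉ K) : (insert i K).card = N :=
    (Finset.card_insert_of_notMem hi).trans hK
  have hinj {i j : Fin d} (hi : i ∉ K) (hj : j ∉ K)
      (h : vertex n c (insert i K) = vertex n c (insert j K)) : i = j :=
    (Finset.insert_inj hi).1 (hgen.vertex_injOn (hcard hi) (hcard hj) h)
  have hIe : ∀ i ∈ I, i ≠ e ∧ i ∉ K := fun i hi => by
    simpa using Finset.disjoint_left.1 hI hi
  set v := vertex n c (insert e K)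
  have hv : v ∈ flat n c K :=
    mem_flat.2 fun j hj => hgen.inner_vertex (hcard he) (Finset.mem_insert_of_mem hj)
  obtain ⟨u, t, hut⟩ := exists_vertex_insert_eq_add_smul hunit hgen hδ hvol hK hv
  have hvertex : ∀ i ∈ I, vertex n c (insert i K) = v + t i • u := fun i hi =>
    (hut i (hIe i hi).2).1
  have ht : Set.InjOn t I := fun i hi j hj hij =>
    hinj (hIe i hi).2 (hIe j hj).2 (by rw [hvertex i hi, hvertex j hj, hij])
  have ht0 : ∀ i ∈ I, t i ≠ 0 := fun i hi h =>
    (hIe i hi).1 (hinj (hIe i hi).2 he (by rw [hvertex i hi, h, zero_smul, add_zero]))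
  have hM0 : 0 ≤ M := (norm_nonneg _).trans (hM v hse)
  calc |g v - evalAt p v| ≤ M / (I.card.factorial : ℝ) * ∏ i ∈ I, ‖t i • u‖ :=
        abs_sub_evalAt_le_prod_norm_smul hk hp hs hg hM hse ht ht0
          (fun i hi => hvertex i hi ▸ hsI i hi) (fun i hi => hvertex i hi ▸ hpI i hi)
    _ ≤ M * ∏ i ∈ I, |inner ℝ (n i) v - c i| / δ := by
        refine mul_le_mul (div_le_self hM0 (by exact_mod_cast I.card.factorial_pos))
          (Finset.prod_le_prod (fun _ _ => norm_nonneg _) fun i hi => (hut i (hIe i hi).2).2)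
          (by positivity) hM0
    _ = M / δ ^ I.card * |evalAt (facePoly n c I) v| := by
        rw [Finset.prod_div_distrib, Finset.prod_const, evalAt_facePoly, Finset.abs_prod]
        ring

theorem evalAt_facePoly_sdiff_vertex_eq_zero_iff (hgen : InGeneralPosition n c)
    {S K H : Finset (Fin d)} {e : Fin d} (he : e ∉ S) (hK : K.card + 1 = N) (hHS : H ⊆ insert e S)
    (hH : H.card = N) :
    evalAt (facePoly n c (S \ K)) (vertex n c H) = 0 ↔ H ≠ insert e K := by
  rw [evalAt_facePoly_vertex_eq_zero_iff (by omega) hgen hH, not_iff_not]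
  constructor
  · intro hdisj
    refine Finset.eq_of_subset_of_card_le (fun i hi => ?_)
      ((Finset.card_insert_le e K).trans (hK.trans hH.symm).le)
    have := Finset.disjoint_left.1 hdisj hi
    have := hHS hi
    grind
  · rintro rfl
    rw [Finset.disjoint_insert_left]
    exact ⟨fun h => he (Finset.mem_sdiff.1 h).1, Finset.disjoint_sdiff⟩

/-- The coefficient of the face polynomial of `S \ K` in the Newton form of the interpolation
polynomial of `g`, when the hyperplane with index `e` is added to the subfamily `S` and `p`
interpolates `g` at the lattice of `S`. -/
noncomputable def newtonCoeff (n : Fin d → Space N) (c : Fin d → ℝ) (S : Finset (Fin d))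
    (e : Fin d) (g : Space N → ℝ) (p : MvPolynomial (Fin N) ℝ) (K : Finset (Fin d)) : ℝ :=
  (g (vertex n c (insert e K)) - evalAt p (vertex n c (insert e K))) /
    evalAt (facePoly n c (S \ K)) (vertex n c (insert e K))

/-- One step of Newton's interpolation scheme: the correction of `p` which restores interpolation
of `g` when the hyperplane with index `e` is added to the subfamily `S`. The index sets `K` of
`N - 1` hyperplanes stand for the lines on which the new vertices lie. -/
noncomputable def newtonStep (n : Fin d → Space N) (c : Fin d → ℝ) (S : Finset (Fin d))
    (e : Fin d) (g : Space N → ℝ) (p : MvPolynomial (Fin N) ℝ) : MvPolynomial (Fin N) ℝ :=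
  p + ∑ K ∈ S.powersetCard (N - 1), MvPolynomial.C (newtonCoeff n c S e g p K) *
    facePoly n c (S \ K)

variable {S : Finset (Fin d)} {e : Fin d} {k : ℕ} {p : MvPolynomial (Fin N) ℝ}

theorem evalAt_newtonStep (x : Space N) : evalAt (newtonStep n c S e g p) x =
    evalAt p x + ∑ K ∈ S.powersetCard (N - 1),
      newtonCoeff n c S e g p K * evalAt (facePoly n c (S \ K)) x := by
  simp only [newtonStep, evalAt_add, evalAt_sum, evalAt_C_mul]

theorem interpolates_newtonStep (hN : 0 < N) (hgen : InGeneralPosition n c) (he : e ∉ S)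
    (hS : S.card = N + k) (hp : Interpolates k (latticeOn n c S) g p) :
    Interpolates (k + 1) (latticeOn n c (insert e S)) g (newtonStep n c S e g p) := by
  refine ⟨Submodule.add_mem _ (restrictTotalDegree_mono k.le_succ hp.1)
    (Submodule.sum_mem _ fun K hK => C_mul_mem_restrictTotalDegree _ ?_),
    forall_mem_latticeOn.2 fun H hHS hH => ?_⟩
  · obtain ⟨hKS, hK⟩ := Finset.mem_powersetCard.1 hK
    have hcard : (S \ K).card = k + 1 := by rw [Finset.card_sdiff_of_subset hKS]; omega
    exact hcard ▸ facePoly_mem_restrictTotalDegree n c (S \ K)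
  have hface {K : Finset (Fin d)} (hK : K ∈ S.powersetCard (N - 1)) :
      evalAt (facePoly n c (S \ K)) (vertex n c H) = 0 ↔ H ≠ insert e K :=
    evalAt_facePoly_sdiff_vertex_eq_zero_iff hgen he
      (by have := (Finset.mem_powersetCard.1 hK).2; omega) hHS hH
  rw [evalAt_newtonStep]
  by_cases heH : e ∈ H
  · have hHe : H.erase e ∈ S.powersetCard (N - 1) := Finset.mem_powersetCard.2
      ⟨Finset.subset_insert_iff.1 hHS, by rw [Finset.card_erase_of_mem heH, hH]⟩
    have hface0 : evalAt (facePoly n c (S \ H.erase e)) (vertex n c H) ≠ 0 := fun h =>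
      (hface hHe).1 h (Finset.insert_erase heH).symm
    rw [Finset.sum_eq_single_of_mem _ hHe, newtonCoeff, Finset.insert_erase heH,
      div_mul_cancel₀ _ hface0, add_sub_cancel]
    intro K hK hKH
    have heK : e ∉ K := fun h => he ((Finset.mem_powersetCard.1 hK).1 h)
    rw [(hface hK).2 fun h => hKH (by rw [h, Finset.erase_insert heK]), mul_zero]
  · rw [Finset.sum_eq_zero, add_zero]
    · exact hp.2 _ (vertex_mem_latticeOn ((Finset.subset_insert_iff_of_notMem heH).1 hHS) hH)
    · intro K hK
      rw [(hface hK).2 fun h => heH (h ▸ Finset.mem_insert_self e K), mul_zero]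

theorem abs_newtonCoeff_le (hunit : ∀ i, ‖n i‖ = 1) (hgen : InGeneralPosition n c) {δ : ℝ}
    (hδ : 0 < δ) (hvol : ∀ i : Fin N ↪o Fin d, δ ≤ vol (fun j => n (i j))) {s : Set (Space N)}
    (hs : Convex ℝ s) (he : e ∉ S) (hS : S.card = N + k) (hSs : latticeOn n c (insert e S) ⊆ s)
    (hg : ∀ y ∈ s, ContDiffAt ℝ (k + 1 : ℕ) g y) {M : ℝ}
    (hM : ∀ y ∈ s, ‖iteratedFDeriv ℝ (k + 1) g y‖ ≤ M)
    (hp : Interpolates k (latticeOn n c S) g p) {K : Finset (Fin d)} (hKS : K ⊆ S)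
    (hK : K.card + 1 = N) : |newtonCoeff n c S e g p K| ≤ M / δ ^ (k + 1) := by
  have heK : e ∉ K := fun h => he (hKS h)
  have hcard {i : Fin d} (hi : i ∉ K) : (insert i K).card = N :=
    (Finset.card_insert_of_notMem hi).trans hK
  have hI : (S \ K).card = k + 1 := by rw [Finset.card_sdiff_of_subset hKS]; omega
  have hface0 : evalAt (facePoly n c (S \ K)) (vertex n c (insert e K)) ≠ 0 := fun h =>
    (evalAt_facePoly_sdiff_vertex_eq_zero_iff hgen he hK (Finset.insert_subset_insert e hKS)
      (hcard heK)).1 h rfl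
  have hmem : ∀ i ∈ S \ K, vertex n c (insert i K) ∈ latticeOn n c S := fun i hi =>
    vertex_mem_latticeOn (Finset.insert_subset (Finset.mem_sdiff.1 hi).1 hKS)
      (hcard (Finset.mem_sdiff.1 hi).2)
  have hdisj : Disjoint (S \ K) (insert e K) := Finset.disjoint_insert_right.2
    ⟨fun h => he (Finset.mem_sdiff.1 h).1, Finset.sdiff_disjoint⟩
  rw [newtonCoeff, abs_div, div_le_iff₀ (abs_pos.2 hface0), ← hI]
  exact abs_sub_evalAt_vertex_le hunit hgen hδ hvol hs hK heK hdisj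
    (hSs (vertex_mem_latticeOn (Finset.insert_subset_insert e hKS) (hcard heK)))
    (fun i hi => hSs (latticeOn_mono (Finset.subset_insert e S) (hmem i hi)))
    (hI.symm ▸ hg) (hI.symm ▸ hM) (k := k) (by omega) hp.1 fun i hi => hp.2 _ (hmem i hi)

/-- The constant in the bound of the Newton form of degree `k` in `N` variables: `ρ` bounds the
ratio between the distances to the hyperplanes and the volume bound `δ`, and the binomial
coefficient counts the lines added with the `j`-th hyperplane. -/
noncomputable def newtonConst (N k : ℕ) (ρ : ℝ) : ℝ :=
  ∑ j ∈ Finset.range (k + 1), ((N - 1 + j).choose (N - 1)) * ρ ^ j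

theorem newtonConst_nonneg (N k : ℕ) {ρ : ℝ} (hρ : 0 ≤ ρ) : 0 ≤ newtonConst N k ρ :=
  Finset.sum_nonneg fun _ _ => by positivity

theorem abs_evalAt_newtonStep_le (hN : 0 < N) (hS : S.card = N + k) {A : ℝ}
    (hA : ∀ K ⊆ S, K.card + 1 = N → |newtonCoeff n c S e g p K| ≤ A) {ρ : ℝ} {x : Space N}
    (hx : ∀ i, |inner ℝ (n i) x - c i| ≤ ρ) :
    |evalAt (newtonStep n c S e g p) x| ≤
      |evalAt p x| + ((N + k).choose (N - 1)) * (A * ρ ^ (k + 1)) := by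
  have hterm : ∀ K ∈ S.powersetCard (N - 1),
      |newtonCoeff n c S e g p K * evalAt (facePoly n c (S \ K)) x| ≤ A * ρ ^ (k + 1) := by
    intro K hK
    obtain ⟨hKS, hKcard⟩ := Finset.mem_powersetCard.1 hK
    have hcard : (S \ K).card = k + 1 := by rw [Finset.card_sdiff_of_subset hKS]; omega
    have hcoeff := hA K hKS (by omega)
    rw [abs_mul, ← hcard]
    exact mul_le_mul hcoeff (abs_evalAt_facePoly_le hx _) (abs_nonneg _)
      ((abs_nonneg _).trans hcoeff)
  rw [evalAt_newtonStep]
  refine (abs_add_le _ _).trans (add_le_add_right ?_ _)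
  refine (Finset.abs_sum_le_sum_abs _ _).trans ((Finset.sum_le_card_nsmul _ _ _ hterm).trans_eq ?_)
  rw [Finset.card_powersetCard, hS, nsmul_eq_mul]

theorem exists_interpolates_latticeOn_abs_evalAt_le (hN : 0 < N) (hunit : ∀ i, ‖n i‖ = 1)
    (hgen : InGeneralPosition n c) {δ : ℝ} (hδ : 0 < δ)
    (hvol : ∀ i : Fin N ↪o Fin d, δ ≤ vol (fun j => n (i j))) {s : Set (Space N)}
    (hs : Convex ℝ s) (hg : ∀ y ∈ s, ContDiffAt ℝ k g y) {M : ℝ}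
    (hM : ∀ j ≤ k, ∀ y ∈ s, ‖iteratedFDeriv ℝ j g y‖ ≤ M) (hS : S.card = N + k)
    (hSs : latticeOn n c S ⊆ s) :
    ∃ p, Interpolates k (latticeOn n c S) g p ∧ ∀ (x : Space N) (ρ : ℝ),
      (∀ i, |inner ℝ (n i) x - c i| ≤ ρ) → |evalAt p x| ≤ newtonConst N k (ρ / δ) * M := by
  induction k generalizing S with
  | zero =>
    refine ⟨MvPolynomial.C (g (vertex n c S)), ⟨by simp [MvPolynomial.mem_restrictTotalDegree],
      forall_mem_latticeOn.2 fun H hHS hH => ?_⟩, fun x ρ _ => ?_⟩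
    · rw [Finset.eq_of_subset_of_card_le hHS (by omega)]
      simp [evalAt]
    · simpa [evalAt, newtonConst] using hM 0 le_rfl _ (hSs (vertex_mem_latticeOn subset_rfl hS))
  | succ k ih =>
    obtain ⟨e, T, he, rfl, hT⟩ := Finset.card_eq_succ.1 hS
    obtain ⟨p, hp, hpM⟩ := ih (fun y hy => (hg y hy).of_le (by exact_mod_cast k.le_succ))
      (fun j hj => hM j (hj.trans k.le_succ)) hT
      ((latticeOn_mono (Finset.subset_insert e T)).trans hSs)
    refine ⟨newtonStep n c T e g p, interpolates_newtonStep hN hgen he hT hp, fun x ρ hx => ?_⟩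
    have hcoeff := fun K => abs_newtonCoeff_le (K := K) hunit hgen hδ hvol hs he hT hSs hg
      (hM _ le_rfl) hp
    calc |evalAt (newtonStep n c T e g p) x|
        ≤ newtonConst N k (ρ / δ) * M +
            ((N + k).choose (N - 1)) * (M / δ ^ (k + 1) * ρ ^ (k + 1)) :=
          (abs_evalAt_newtonStep_le hN hT hcoeff hx).trans (add_le_add_left (hpM x ρ hx) _)
      _ = newtonConst N (k + 1) (ρ / δ) * M := by
          rw [newtonConst, newtonConst, Finset.sum_range_succ _ (k + 1),
            show N - 1 + (k + 1) = N + k by omega, div_pow]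
          ring

end Newton

section Estimate

variable {N d : ℕ}

theorem le_maxOn {α : Type*} {B : Set α} {g : α → ℝ} (hg : BddAbove (g '' B)) {a : α}
    (ha : a ∈ B) : g a ≤ maxOn B g :=
  le_csSup hg (Set.mem_image_of_mem g ha)

theorem maxOn_le {α : Type*} {B : Set α} {g : α → ℝ} {M : ℝ} (hM : 0 ≤ M)
    (hg : ∀ a ∈ B, g a ≤ M) : maxOn B g ≤ M :=
  Real.sSup_le (Set.forall_mem_image.2 hg) hM

theorem maxOn_nonneg {α : Type*} {B : Set α} {g : α → ℝ} (hg : ∀ a ∈ B, 0 ≤ g a) :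
    0 ≤ maxOn B g :=
  Real.sSup_nonneg (Set.forall_mem_image.2 hg)

theorem latticeNorm_nonneg (A : Set (Space N)) : 0 ≤ latticeNorm A :=
  maxOn_nonneg fun _ _ => norm_nonneg _

theorem latticeNorm_le {A : Set (Space N)} {R : ℝ} (hR : 0 ≤ R)
    (hA : A ⊆ Metric.closedBall 0 R) : latticeNorm A ≤ R :=
  maxOn_le hR fun _ ha => mem_closedBall_zero_iff.1 (hA ha)

theorem subset_closedBall_latticeNorm {A : Set (Space N)} {R : ℝ}
    (hA : A ⊆ Metric.closedBall 0 R) : A ⊆ Metric.closedBall 0 (latticeNorm A) := fun _ ha =>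
  mem_closedBall_zero_iff.2 <| le_maxOn
    ⟨R, Set.forall_mem_image.2 fun _ hb => mem_closedBall_zero_iff.1 (hA hb)⟩ ha

theorem lagrange_sub_eq {k : ℕ} {A : Set (Space N)} (hA : IsInterpolationLattice k A)
    {f g : Space N → ℝ} {p q : MvPolynomial (Fin N) ℝ}
    (hq : q ∈ MvPolynomial.restrictTotalDegree (Fin N) ℝ k)
    (hg : ∀ a ∈ A, g a = f a - evalAt q a) (hp : Interpolates k A g p) :
    lagrange k A f - q = p := by
  have hf := interpolates_lagrange hA f
  refine (hA g).unique ⟨Submodule.sub_mem _ hf.1 hq, fun a ha => ?_⟩ hp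
  rw [evalAt_sub, hf.2 a ha, hg a ha]

variable {n : Fin d → Space N} {c : Fin d → ℝ}

theorem abs_le_of_lattice_subset_closedBall (hN : 0 < N) (hd : N ≤ d)
    (hgen : InGeneralPosition n c) {R : ℝ} (hlat : lattice n c ⊆ Metric.closedBall 0 R) {i : Fin d}
    (hi : ‖n i‖ = 1) : |c i| ≤ R := by
  obtain ⟨H, hiH, -, hH⟩ := Finset.exists_subsuperset_card_eq (n := N)
    (Finset.subset_univ {i}) (by rw [Finset.card_singleton]; exact hN) (by simpa using hd)
  have hmem : vertex n c H ∈ lattice n c :=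
    hgen.latticeOn_univ ▸ vertex_mem_latticeOn (Finset.subset_univ H) hH
  calc |c i| = |inner ℝ (n i) (vertex n c H)| := by
        rw [hgen.inner_vertex hH (Finset.singleton_subset_iff.1 hiH)]
    _ ≤ ‖n i‖ * ‖vertex n c H‖ := abs_real_inner_le_norm _ _
    _ ≤ R := by rw [hi, one_mul]; exact mem_closedBall_zero_iff.1 (hlat hmem)

theorem norm_iteratedFDeriv_sub_taylorSum_le_mul {k : ℕ} {f : Space N → ℝ} {r R M : ℝ}
    (hr : 0 ≤ r) (hrR : r ≤ R)
    (hf : ∀ a ∈ Metric.closedBall (0 : Space N) r, ContDiffAt ℝ (k + 1 : ℕ) f a)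
    (hM : ∀ a ∈ Metric.closedBall (0 : Space N) r, ‖iteratedFDeriv ℝ (k + 1) f a‖ ≤ M) {j : ℕ}
    (hj : j ≤ k) : ∀ a ∈ Metric.closedBall (0 : Space N) r,
      ‖iteratedFDeriv ℝ j (f - taylorSum k f 0) a‖ ≤ max 1 R ^ k * (r * M) := by
  intro a ha
  have hM0 : 0 ≤ M := (norm_nonneg _).trans (hM a ha)
  calc ‖iteratedFDeriv ℝ j (f - taylorSum k f 0) a‖ ≤ M * r ^ (k + 1 - j) :=
        norm_iteratedFDeriv_sub_taylorSum_le hr hf hM (hj.trans k.le_succ) a ha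
    _ = r ^ (k - j) * (r * M) := by rw [Nat.sub_add_comm hj, pow_succ]; ring
    _ ≤ max 1 R ^ k * (r * M) := by
        have hpow : r ^ (k - j) ≤ max 1 R ^ k :=
          (pow_le_pow_left₀ hr (hrR.trans (le_max_right 1 R)) _).trans
            (pow_le_pow_right₀ (le_max_left 1 R) (k.sub_le j))
        gcongr

theorem abs_lagrange_sub_taylorAtZero_le (hN : 0 < N) (hd : N ≤ d) (hunit : ∀ i, ‖n i‖ = 1)
    (hgen : InGeneralPosition n c) {δ R M : ℝ} (hδ : 0 < δ)
    (hvol : ∀ i : Fin N ↪o Fin d, δ ≤ vol (fun j => n (i j)))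
    (hlat : lattice n c ⊆ Metric.closedBall 0 R) {f : Space N → ℝ}
    (hf : ∀ a ∈ Metric.closedBall (0 : Space N) R, ContDiffAt ℝ (d - N + 1 : ℕ) f a)
    (hM : ∀ a ∈ Metric.closedBall (0 : Space N) R, ‖iteratedFDeriv ℝ (d - N + 1) f a‖ ≤ M)
    {x : Space N} (hx : x ∈ Metric.closedBall 0 R) :
    |evalAt (lagrange (d - N) (lattice n c) f) x - taylorAtZero (d - N) f x| ≤
      newtonConst N (d - N) (2 * R / δ) * max 1 R ^ (d - N) * (latticeNorm (lattice n c) * M) := by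
  rw [mem_closedBall_zero_iff] at hx
  set r := latticeNorm (lattice n c)
  have hrR : r ≤ R := latticeNorm_le ((norm_nonneg x).trans hx) hlat
  have hball := Metric.closedBall_subset_closedBall (x := (0 : Space N)) hrR
  have hinner (i : Fin d) : |inner ℝ (n i) x - c i| ≤ 2 * R := by
    have hix : |inner ℝ (n i) x| ≤ R :=
      (abs_real_inner_le_norm _ _).trans (by rwa [hunit, one_mul])
    linarith [abs_sub (inner ℝ (n i) x) (c i),
      abs_le_of_lattice_subset_closedBall hN hd hgen hlat (hunit i)]
  obtain ⟨q, hq, hqf⟩ := exists_evalAt_eq_taylorAtZero (d - N) f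
  have htaylor : taylorSum (d - N) f 0 = taylorAtZero (d - N) f :=
    funext fun y => by simp [taylorSum, taylorAtZero]
  obtain ⟨p, hp, hpx⟩ := exists_interpolates_latticeOn_abs_evalAt_le
    (g := f - taylorSum (d - N) f 0) (S := Finset.univ) (k := d - N) hN hunit hgen hδ hvol
    (convex_closedBall 0 r)
    (fun y hy => ((hf y (hball hy)).of_le (by exact_mod_cast Nat.le_succ _)).sub
      (contDiff_taylorSum ..).contDiffAt)
    (fun j hj => norm_iteratedFDeriv_sub_taylorSum_le_mul (latticeNorm_nonneg _) hrR
      (fun a ha => hf a (hball ha)) (fun a ha => hM a (hball ha)) hj)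
    (by simp [hd]) (by rw [hgen.latticeOn_univ]; exact subset_closedBall_latticeNorm hlat)
  rw [hgen.latticeOn_univ] at hp
  have heq : lagrange (d - N) (lattice n c) f - q = p :=
    lagrange_sub_eq (isInterpolationLattice_lattice hN hd hgen) hq
      (fun a _ => by rw [Pi.sub_apply, hqf, htaylor]) hp
  rw [← hqf, ← evalAt_sub, heq, mul_assoc]
  exact hpx x (2 * R) hinner

end Estimate

end ChungYao

open ChungYao in
theorem corollary4p9_general {ι : Type*} {N d : ℕ} (hN : 0 < N) (hd : N ≤ d)
    (n : ι → Fin d → Space N) (c : ι → Fin d → ℝ) (hunit : ∀ s i, ‖n s i‖ = 1)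
    (hgen : ∀ s, InGeneralPosition (n s) (c s))
    (hC2 : ∃ δ : ℝ, 0 < δ ∧ ∀ (s : ι) (i : Fin N ↪o Fin d), δ ≤ vol (fun j => n s (i j)))
    {R : ℝ} (hR : 0 ≤ R) :
    (∀ s, IsInterpolationLattice (d - N) (lattice (n s) (c s))) ∧
    ∃ C : ℝ, 0 ≤ C ∧ ∀ s : ι, lattice (n s) (c s) ⊆ Metric.closedBall 0 R →
      ∀ f : Space N → ℝ, (∀ a ∈ Metric.closedBall 0 R, ContDiffAt ℝ (d - N + 1 : ℕ) f a) →
        ChungYao.maxOn (Metric.closedBall 0 R) (fun x =>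
            |evalAt (lagrange (d - N) (lattice (n s) (c s)) f) x - taylorAtZero (d - N) f x|)
          ≤ C * (latticeNorm (lattice (n s) (c s)) *
              ChungYao.maxOn (Metric.closedBall 0 R) fun a =>
                ‖iteratedFDeriv ℝ (d - N + 1) f a‖) := by
  obtain ⟨δ, hδ, hvol⟩ := hC2
  have hC : 0 ≤ newtonConst N (d - N) (2 * R / δ) * max 1 R ^ (d - N) :=
    mul_nonneg (newtonConst_nonneg _ _ (by positivity)) (by positivity)
  refine ⟨fun s => isInterpolationLattice_lattice hN hd (hgen s), _, hC, fun s hlat f hf => ?_⟩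
  have hcont : ContinuousOn (fun a => ‖iteratedFDeriv ℝ (d - N + 1) f a‖)
      (Metric.closedBall 0 R) := fun a ha =>
    ((hf a ha).iteratedFDeriv_right (m := 0) (by simp)).continuousAt.norm.continuousWithinAt
  refine maxOn_le (mul_nonneg hC (mul_nonneg (latticeNorm_nonneg _)
    (maxOn_nonneg fun _ _ => norm_nonneg _))) fun x hx => ?_
  exact abs_lagrange_sub_taylorAtZero_le hN hd (hunit s) (hgen s) hδ (hvol s) hlat hf
    (fun a ha => le_maxOn ((isCompact_closedBall 0 R).bddAbove_image hcont) ha) hx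

theorem corollary4p9 (N d : ℕ) (hN : 2 ≤ N) (hd : N ≤ d)
    (n : ℕ → Fin d → ChungYao.Space N) (c : ℕ → Fin d → ℝ)
    (hunit : ∀ s i, ‖n s i‖ = 1)
    (hgen : ∀ s, ChungYao.InGeneralPosition (n s) (c s))
    (hC1 : Filter.Tendsto (fun s => ChungYao.latticeNorm (ChungYao.lattice (n s) (c s)))
      Filter.atTop (nhds 0))
    (hC2 : ∃ δ : ℝ, 0 < δ ∧ ∀ (s : ℕ) (i : Fin N ↪o Fin d),
      δ ≤ ChungYao.vol (fun j => n s (i j)))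
    (R : ℝ) (hR : 0 < R) :
    (∀ s, ChungYao.IsInterpolationLattice (d - N) (ChungYao.lattice (n s) (c s))) ∧
    ∃ C : ℝ, ∀ s : ℕ,
      ChungYao.lattice (n s) (c s) ⊆ Metric.closedBall 0 R →
      ∀ (Ω : Set (ChungYao.Space N)), IsOpen Ω → Metric.closedBall 0 R ⊆ Ω →
      ∀ f : ChungYao.Space N → ℝ, ContDiffOn ℝ ((d - N + 2 : ℕ) : WithTop ℕ∞) f Ω →
        ChungYao.maxOn (Metric.closedBall 0 R) (fun x =>
            |ChungYao.evalAt
                (ChungYao.lagrange (d - N) (ChungYao.lattice (n s) (c s)) f) x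
              - ChungYao.taylorAtZero (d - N) f x|)
          ≤ C * (ChungYao.latticeNorm (ChungYao.lattice (n s) (c s)) *
              (ChungYao.maxOn (Metric.closedBall 0 R)
                  (fun a => ‖iteratedFDeriv ℝ (d - N + 1) f a‖)
                + ChungYao.maxOn (Metric.closedBall 0 R)
                  (fun a => ‖iteratedFDeriv ℝ (d - N + 2) f a‖))) := by
  obtain ⟨hL, C, hC, hbound⟩ :=
    corollary4p9_general (by omega) hd n c hunit hgen hC2 hR.le
  refine ⟨hL, C, fun s hlat Ω hΩ hball f hf => (hbound s hlat f fun a ha => ?_).trans ?_⟩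
  · exact (hf.contDiffAt (hΩ.mem_nhds (hball ha))).of_le (by exact_mod_cast Nat.le_succ _)
  · refine mul_le_mul_of_nonneg_left (mul_le_mul_of_nonneg_left ?_
      (ChungYao.latticeNorm_nonneg _)) hC
    exact le_add_of_nonneg_right (ChungYao.maxOn_nonneg fun _ _ => norm_nonneg _)
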